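/- All rings are commutative with $1$. Let $\varphi\colon A\to B$ be a crisp ring homomorphism, i.e. one for which the map $\varphi\otimes\mathrm{id}_P\colon A\otimes_A P\to B\otimes_A P$ is injective for every $A$-module $P$ (such homomorphisms are also called pure, or universally injective). Let $R$ be an $A$-algebra. Then: 1. if $R\otimes_A B$ is a formally unramified $B$-algebra, then $R$ is a formally unramified $A$-algebra; 2. if $R\otimes_A B$ is an unramified $B$-algebra, then $R$ is an unramified $A$-algebra; 3. if $R\otimes_A B$ is an étale $B$-algebra, then $R$ is an étale $A$-algebra; 4. if $R\otimes_A B$ is a smooth $B$-algebra, then $R$ is a smooth $A$-algebra. Here unramified means formally unramified and of finite type, étale means formally étale and of finite presentation, and smooth means formally smooth and of finite presentation. -/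

import Mathlib

open scoped TensorProduct

universe u v w

/-- A linear map `f : M → N` of `A`-modules is *crisp* (pure, universally injective) if
`f ⊗ id : M ⊗[A] P → N ⊗[A] P` is injective for all `A`-modules `P`.
Modules `P` in the universe of `A` suffice: see `IsCrispMap.rTensor_injective`, which
gives the injectivity for `A`-modules `P` in an arbitrary universe. -/
def IsCrispMap {A : Type u} [CommRing A] {M : Type v} {N : Type w}
    [AddCommGroup M] [Module A M] [AddCommGroup N] [Module A N] (f : M →ₗ[A] N) : Prop :=
  ∀ (P : Type u) [AddCommGroup P] [Module A P], Function.Injective (f.rTensor P)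

/-- An algebra `B` over `A` (that is, the ring homomorphism `A → B`) is *crisp* if `A → B` is
crisp as a map of `A`-modules. -/
def IsCrispAlgebra (A : Type u) (B : Type v) [CommRing A] [CommRing B] [Algebra A B] : Prop :=
  IsCrispMap (Algebra.linearMap A B)

/-- The choice of universe in `IsCrispMap` is immaterial. -/
theorem IsCrispMap.rTensor_injective {A : Type u} [CommRing A] {M : Type v} {N : Type w}
    [AddCommGroup M] [Module A M] [AddCommGroup N] [Module A N] {f : M →ₗ[A] N}
    (hf : IsCrispMap f) (P : Type*) [AddCommGroup P] [Module A P] :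
    Function.Injective (f.rTensor P) := by
  rw [← LinearMap.lTensor_inj_iff_rTensor_inj, injective_iff_map_eq_zero]
  intro x hx
  obtain ⟨Q, hQ, t, rfl⟩ := TensorProduct.exists_of_fg x
  have h0 : LinearMap.rTensor N Q.subtype (f.lTensor Q t) = LinearMap.rTensor N Q.subtype 0 := by
    rw [map_zero, ← hx, ← LinearMap.comp_apply, ← LinearMap.comp_apply,
      LinearMap.rTensor_comp_lTensor, LinearMap.lTensor_comp_rTensor]
  obtain ⟨Q', hQQ', hQ', h1⟩ := TensorProduct.eq_of_fg_of_subtype_eq hQ h0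
  have : Small.{u} Q' := Submodule.FG.small Q' hQ'
  let e : Shrink.{u} Q' ≃ₗ[A] Q' := Shrink.linearEquiv A Q'
  have hinj : Function.Injective (f.lTensor Q') := by
    have h2 := (LinearMap.lTensor_inj_iff_rTensor_inj (Shrink.{u} Q') f).2 (hf (Shrink.{u} Q'))
    have h3 : f.lTensor Q' =
        (e.rTensor N).toLinearMap ∘ₗ f.lTensor (Shrink.{u} Q') ∘ₗ
          (e.symm.rTensor M).toLinearMap := by
      ext a b
      simp
    rw [h3]
    exact (e.rTensor N).injective.comp (h2.comp (e.symm.rTensor M).injective)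
  have h4 : (Submodule.inclusion hQQ').rTensor M t = 0 := by
    apply hinj
    rw [map_zero, ← LinearMap.comp_apply, LinearMap.lTensor_comp_rTensor,
      ← LinearMap.rTensor_comp_lTensor, LinearMap.comp_apply, h1, map_zero]
  have h5 : Q.subtype = Q'.subtype ∘ₗ Submodule.inclusion hQQ' := by
    ext
    rfl
  rw [h5, LinearMap.rTensor_comp, LinearMap.comp_apply, h4, map_zero]

/-!
If `A → B` is crisp, every `A`-module embeds into its base change to `B`. Applied to quotient
modules, this says that a submodule is the contraction of its extension, so finite generation,
vanishing (of `Ω[R⁄A]`, say) and solvability of linear systems descend from `B` to `A`.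

Smoothness of a finitely presented algebra is such a linear system. Let `I` be the ideal of
relations, generated by `F`, with Jacobian matrix `J`. The algebra is formally smooth if and only if
`I ⧸ I ^ 2 → R ⊗ Ω` has a retraction. As `R ⊗ Ω` is free on the `dXᵢ`, a retraction amounts to
values `p` in `I` for the `dXᵢ` with `F ≡ J p` modulo `I ^ 2`, and the module of right-hand sides
for which such a `p` exists commutes with base change. Finally, étale means formally unramified
and smooth.
-/

open MvPolynomial Algebra

attribute [local instance] MvPolynomial.algebraMvPolynomial

section FirstOrderVariations

variable {S ι σ : Type*} [CommRing S]

/-- For the Jacobian matrix `J` of a family `F` of polynomials and an ideal `I`, these are the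
families congruent modulo `I ^ 2` to the first order term `J p` of `F (X + p)` for some change of
variables `p` with entries in `I`. -/
noncomputable def firstOrderVariations [Fintype ι] (I : Ideal S) (J : Matrix σ ι S) :
    Submodule S (σ → S) :=
  (Submodule.pi .univ fun _ : ι ↦ I).map J.mulVecLin ⊔ Submodule.pi .univ fun _ : σ ↦ I ^ 2

theorem mem_firstOrderVariations_iff [Fintype ι] {I : Ideal S} {J : Matrix σ ι S} {G : σ → S} :
    G ∈ firstOrderVariations I J ↔ ∃ p : ι → I, ∀ j, G j - ∑ i, J j i * p i ∈ I ^ 2 := by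
  constructor
  · intro hG
    obtain ⟨_, ⟨p, hp, rfl⟩, q, hq, rfl⟩ := Submodule.mem_sup.mp hG
    refine ⟨fun i ↦ ⟨p i, hp i trivial⟩, fun j ↦ ?_⟩
    simpa [Matrix.mulVec, dotProduct] using hq j trivial
  · rintro ⟨p, hp⟩
    refine Submodule.mem_sup.mpr
      ⟨_, ⟨fun i ↦ p i, fun i _ ↦ (p i).2, rfl⟩, _, fun j _ ↦ hp j, add_sub_cancel _ _⟩

variable {T : Type*} [CommRing T] [Algebra S T]

theorem pi_map_le_span_image [Finite ι] (I : ι → Ideal S) :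
    Submodule.pi .univ (fun i ↦ (I i).map (algebraMap S T)) ≤
      Submodule.span T ((Algebra.linearMap S T).compLeft ι '' Submodule.pi .univ I) := by
  classical
  cases nonempty_fintype ι
  intro x hx
  rw [← Finset.univ_sum_single x]
  refine sum_mem fun i _ ↦ ?_
  suffices h : (I i).map (algebraMap S T) ≤ (Submodule.span T ((Algebra.linearMap S T).compLeft ι ''
      Submodule.pi .univ I)).comap (LinearMap.single T (fun _ ↦ T) i) from h (hx i trivial)
  rw [Ideal.map_le_iff_le_comap]
  intro a ha
  have ha' : Pi.single i a ∈ Submodule.pi .univ I := Submodule.le_comap_single_pi I ha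
  refine Submodule.subset_span ⟨Pi.single i a, ha', ?_⟩
  ext j
  by_cases h : j = i <;> simp [h]

theorem firstOrderVariations_map_le [Fintype ι] [Finite σ] (I : Ideal S) (J : Matrix σ ι S) :
    firstOrderVariations (I.map (algebraMap S T)) (J.map (algebraMap S T)) ≤
      Submodule.span T ((Algebra.linearMap S T).compLeft σ '' firstOrderVariations I J) := by
  refine sup_le ?_ ?_
  · refine (Submodule.map_mono (pi_map_le_span_image _)).trans ?_
    rw [Submodule.map_span, Submodule.span_le]
    rintro _ ⟨_, ⟨p, hp, rfl⟩, rfl⟩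
    refine Submodule.subset_span
      ⟨_, Submodule.mem_sup_left (Submodule.mem_map_of_mem hp), funext fun j ↦ ?_⟩
    simp [Matrix.mulVec, dotProduct]
  · rw [← Ideal.map_pow]
    exact (pi_map_le_span_image _).trans
      (Submodule.span_mono (Set.image_mono (SetLike.coe_subset_coe.mpr le_sup_right)))

end FirstOrderVariations

section Smoothness

variable {A R ι σ : Type*} [CommRing A] [CommRing R] [Algebra A R]

theorem comp_cotangentComplex_eq_id_iff [Fintype ι] {E : Extension A R}
    {b : Module.Basis ι R E.CotangentSpace} {F : σ → E.ker}
    (hF : Ideal.span (Set.range fun j ↦ (F j : E.Ring)) = E.ker) {J : Matrix σ ι E.Ring}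
    (hJ : ∀ j i, b.repr (E.cotangentComplex (.mk (F j))) i = algebraMap E.Ring R (J j i))
    {l : E.CotangentSpace →ₗ[R] E.Cotangent} {p : ι → E.ker} (hl : ∀ i, l (b i) = .mk (p i)) :
    l ∘ₗ E.cotangentComplex = LinearMap.id ↔
      ∀ j, (F j : E.Ring) - ∑ i, J j i * p i ∈ E.ker ^ 2 := by
  have hlF (j : σ) : l (E.cotangentComplex (.mk (F j))) = .mk (∑ i, J j i • p i) := by
    rw [← b.sum_repr (E.cotangentComplex (.mk (F j)))]
    simp only [map_sum, LinearMap.map_smul l, hl, hJ]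
    simp only [algebraMap_smul, map_smul]
  calc
    l ∘ₗ E.cotangentComplex = LinearMap.id ↔
        ∀ j, l (E.cotangentComplex (.mk (F j))) = .mk (F j) :=
      ⟨fun h j ↦ LinearMap.congr_fun h _, fun h ↦ LinearMap.ext_on_range
        (Extension.Cotangent.span_eq_top_of_span_eq_ker (fun j ↦ (F j : E.Ring)) hF) h⟩
    _ ↔ ∀ j, (F j : E.Ring) - ∑ i, J j i * p i ∈ E.ker ^ 2 := by
      refine forall_congr' fun j ↦ ?_
      rw [hlF, eq_comm, Extension.Cotangent.mk_eq_mk_iff_sub_mem]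
      simp

theorem formallySmooth_iff_mem_firstOrderVariations [Fintype ι] (E : Extension A R)
    [FormallySmooth A E.Ring] (b : Module.Basis ι R E.CotangentSpace) {F : σ → E.ker}
    (hF : Ideal.span (Set.range fun j ↦ (F j : E.Ring)) = E.ker) {J : Matrix σ ι E.Ring}
    (hJ : ∀ j i, b.repr (E.cotangentComplex (.mk (F j))) i = algebraMap E.Ring R (J j i)) :
    FormallySmooth A R ↔ (fun j ↦ (F j : E.Ring)) ∈ firstOrderVariations E.ker J := by
  rw [E.formallySmooth_iff_split_injection, mem_firstOrderVariations_iff]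
  constructor
  · rintro ⟨l, hl⟩
    choose p hp using fun i ↦ Extension.Cotangent.mk_surjective (l (b i))
    exact ⟨p, (comp_cotangentComplex_eq_id_iff hF hJ fun i ↦ (hp i).symm).mp hl⟩
  · rintro ⟨p, hp⟩
    exact ⟨b.constr R fun i ↦ .mk (p i),
      (comp_cotangentComplex_eq_id_iff hF hJ (b.constr_basis R _)).mpr hp⟩

/-- The Jacobian matrix `(∂Fⱼ / ∂Xᵢ)` of the relations `Fⱼ` of a presentation, before its entries
are reduced to the presented algebra. -/
noncomputable def relationJacobian (P : Presentation A R ι σ) : Matrix σ ι P.Ring :=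
  .of fun j i ↦ pderiv i (P.relation j)

theorem formallySmooth_iff_relation_mem_firstOrderVariations [Fintype ι]
    (P : Presentation A R ι σ) :
    FormallySmooth A R ↔ P.relation ∈ firstOrderVariations P.ker (relationJacobian P) :=
  have : FormallySmooth A P.toExtension.Ring :=
    inferInstanceAs (FormallySmooth A (MvPolynomial ι A))
  formallySmooth_iff_mem_firstOrderVariations P.toExtension P.cotangentSpaceBasis
    (F := fun j ↦ ⟨P.relation j, P.relation_mem_ker j⟩) P.span_range_relation_eq_ker
    fun _ i ↦ (P.cotangentSpaceBasis_repr_one_tmul _ i).trans (P.algebraMap_apply _).symm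

end Smoothness

section BaseChange

variable {A R ι σ : Type*} [CommRing A] [CommRing R] [Algebra A R] (B : Type*) [CommRing B]
  [Algebra A B]

theorem ker_generators_baseChange (P : Generators A R ι) :
    (P.baseChange B).ker = P.ker.map (algebraMap (MvPolynomial ι A) (MvPolynomial ι B)) := by
  let Q : Presentation A R ι P.ker :=
    { P with
      relation := Subtype.val
      span_range_relation_eq_ker := by rw [Subtype.range_coe]; exact Ideal.span_eq _ }
  calc
    (P.baseChange B).ker = Ideal.span (Set.range (Q.baseChange B).relation) :=
      (Q.baseChange B).span_range_relation_eq_ker.symm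
    _ = (Ideal.span (Set.range Q.relation)).map (algebraMap _ _) := by
      rw [Ideal.map_span, ← Set.range_comp]; rfl
    _ = P.ker.map (algebraMap _ _) := by rw [Q.span_range_relation_eq_ker]

theorem relationJacobian_baseChange (P : Presentation A R ι σ) :
    relationJacobian (P.baseChange B) =
      (relationJacobian P).map (algebraMap (MvPolynomial ι A) (MvPolynomial ι B)) :=
  Matrix.ext fun _ _ ↦ pderiv_map

end BaseChange

namespace IsCrispAlgebra

section Module

variable {A : Type u} {B : Type v} [CommRing A] [CommRing B] [Algebra A B]

theorem mk_injective (hAB : IsCrispAlgebra A B) (M : Type*) [AddCommGroup M] [Module A M] :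
    Function.Injective (TensorProduct.mk A B M 1) := by
  convert (IsCrispMap.rTensor_injective hAB M).comp (TensorProduct.lid A M).symm.injective
    using 1
  ext m
  simp

theorem of_mk_injective (h : ∀ (M : Type u) [AddCommGroup M] [Module A M],
    Function.Injective (TensorProduct.mk A B M 1)) : IsCrispAlgebra A B := by
  intro M _ _
  have hcomp : (Algebra.linearMap A B).rTensor M =
      TensorProduct.mk A B M 1 ∘ₗ TensorProduct.lid A M := by
    ext m
    simp
  rw [hcomp]
  exact (h M).comp (TensorProduct.lid A M).injective

theorem of_isPushout (hAB : IsCrispAlgebra A B) (A' : Type w) (B' : Type*) [CommRing A']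
    [CommRing B'] [Algebra A A'] [Algebra A B'] [Algebra A' B'] [Algebra B B']
    [IsScalarTower A A' B'] [IsScalarTower A B B'] [Algebra.IsPushout A B A' B'] :
    IsCrispAlgebra A' B' := by
  refine of_mk_injective fun M _ _ ↦ ?_
  let _ : Module A M := Module.compHom M (algebraMap A A')
  have : IsScalarTower A A' M := .of_algebraMap_smul fun _ _ ↦ rfl
  refine Function.Injective.of_comp (f := Algebra.IsPushout.cancelBaseChange A B A' B' M) ?_
  convert hAB.mk_injective M using 1
  ext m
  simp

theorem mem_of_mem_span_image (hAB : IsCrispAlgebra A B) {M M' : Type*} [AddCommGroup M]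
    [Module A M] [AddCommGroup M'] [Module A M'] [Module B M'] [IsScalarTower A B M']
    {j : M →ₗ[A] M'} (hj : IsBaseChange B j) {W : Submodule A M} {t : M}
    (ht : j t ∈ Submodule.span B (j '' W)) : t ∈ W := by
  let q : M' →ₗ[B] B ⊗[A] (M ⧸ W) := hj.lift (TensorProduct.mk A B (M ⧸ W) 1 ∘ₗ W.mkQ)
  have hq (m : M) : q (j m) = TensorProduct.mk A B (M ⧸ W) 1 (W.mkQ m) := hj.lift_eq _ m
  have hW : Submodule.span B (j '' W) ≤ LinearMap.ker q := by
    rw [Submodule.span_le]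
    rintro _ ⟨w, hw, rfl⟩
    simp [hq, (Submodule.Quotient.mk_eq_zero W).mpr hw]
  have hqt : TensorProduct.mk A B (M ⧸ W) 1 (W.mkQ t) = 0 := by
    rw [← hq]
    exact hW ht
  rw [map_eq_zero_iff _ (hAB.mk_injective _)] at hqt
  simpa using hqt

theorem fg_of_fg_map (hAB : IsCrispAlgebra A B) {I : Ideal A}
    (hI : (I.map (algebraMap A B)).FG) : I.FG := by
  classical
  obtain ⟨s, hs, hspan⟩ := (Submodule.fg_span_iff_fg_span_finset_subset _).mp hI
  obtain ⟨t, ht, rfl⟩ := Finset.subset_set_image_iff.mp hs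
  refine ⟨t, le_antisymm (Submodule.span_le.mpr ht) fun a ha ↦ ?_⟩
  refine hAB.mem_of_mem_span_image (IsBaseChange.linearMap A B) ?_
  suffices algebraMap A B a ∈ (Ideal.span t).map (algebraMap A B) from this
  rw [Ideal.map_span, ← Finset.coe_image]
  exact hspan.le (Submodule.subset_span ⟨a, ha, rfl⟩)

end Module

section Descent

variable {A B R : Type*} [CommRing A] [CommRing B] [CommRing R] [Algebra A B] [Algebra A R]

theorem eq_top_of_baseChange_eq_top (hAB : IsCrispAlgebra A B) {C : Subalgebra A R}
    (hC : C.baseChange B = ⊤) : C = ⊤ := by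
  refine eq_top_iff.mpr fun r _ ↦ ?_
  refine hAB.mem_of_mem_span_image (W := C.toSubmodule) (TensorProduct.isBaseChange A R B) ?_
  have hr : 1 ⊗ₜ r ∈ C.baseChange B := hC ▸ mem_top
  have hspan := C.toSubmodule.baseChange_eq_span (A := B)
  exact hspan.le hr

theorem formallyUnramified (hAB : IsCrispAlgebra A B) [FormallyUnramified B (B ⊗[A] R)] :
    FormallyUnramified A R := by
  let _ : Algebra R (B ⊗[A] R) := Algebra.TensorProduct.rightAlgebra
  have : Subsingleton (B ⊗[A] Ω[R⁄A]) :=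
    (KaehlerDifferential.tensorKaehlerEquivBase A B R (B ⊗[A] R)).subsingleton
  exact ⟨(hAB.mk_injective _).subsingleton⟩

theorem finiteType (hAB : IsCrispAlgebra A B) [FiniteType B (B ⊗[A] R)] : FiniteType A R := by
  classical
  obtain ⟨s, hs⟩ := FiniteType.out (R := B) (A := B ⊗[A] R)
  choose S hS using fun x : B ⊗[A] R ↦ TensorProduct.exists_finset x
  let t : Finset R := s.biUnion fun x ↦ (S x).image Prod.snd
  have hst : ∀ x ∈ s, x ∈ (adjoin A t).baseChange B := by
    intro x hx
    rw [hS x]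
    refine sum_mem fun i hi ↦ Subalgebra.tmul_mem_baseChange (subset_adjoin ?_) i.1
    exact Finset.mem_biUnion.mpr ⟨x, hx, Finset.mem_image_of_mem _ hi⟩
  exact ⟨t, hAB.eq_top_of_baseChange_eq_top (_root_.eq_top_iff.mpr (hs ▸ adjoin_le hst))⟩

theorem finitePresentation (hAB : IsCrispAlgebra A B) [FinitePresentation B (B ⊗[A] R)] :
    FinitePresentation A R := by
  obtain ⟨n, f, hf⟩ := FiniteType.iff_quotient_mvPolynomial''.mp (hAB.finiteType (R := R))
  let P : Generators A R (Fin n) := .ofAlgHom f hf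
  have hP : (P.baseChange B).ker.FG := (P.baseChange B).fg_ker_of_finitePresentation
  rw [ker_generators_baseChange] at hP
  have hker := (hAB.of_isPushout (MvPolynomial (Fin n) A) (MvPolynomial (Fin n) B)).fg_of_fg_map hP
  rw [P.ker_eq_ker_aeval_val] at hker
  exact .of_surjective P.aeval_val_surjective hker

theorem formallySmooth (hAB : IsCrispAlgebra A B) [FinitePresentation A R]
    [FormallySmooth B (B ⊗[A] R)] : FormallySmooth A R := by
  let P := Presentation.ofFinitePresentation A R
  have hker : (P.baseChange B).ker = P.ker.map (algebraMap (MvPolynomial _ A) (MvPolynomial _ B)) :=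
    ker_generators_baseChange B P.toGenerators
  have hB : (P.baseChange B).relation ∈
      firstOrderVariations (P.baseChange B).ker (relationJacobian (P.baseChange B)) :=
    (formallySmooth_iff_relation_mem_firstOrderVariations _).mp inferInstance
  rw [relationJacobian_baseChange, hker] at hB
  rw [formallySmooth_iff_relation_mem_firstOrderVariations P]
  exact (hAB.of_isPushout (MvPolynomial _ A) (MvPolynomial _ B)).mem_of_mem_span_image
    ((IsBaseChange.linearMap _ _).finitePow _) (firstOrderVariations_map_le _ _ hB)

theorem smooth (hAB : IsCrispAlgebra A B) [Smooth B (B ⊗[A] R)] : Smooth A R :=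
  have := hAB.finitePresentation (R := R)
  ⟨hAB.formallySmooth, this⟩

end Descent

end IsCrispAlgebra

/-- Descent of differential properties of an algebra `R` along a crisp ring homomorphism `A → B`.
The base change of `R` to `B` is written `B ⊗[A] R`, with its left `B`-algebra structure. -/
theorem proposition1p11 {A : Type u} {B : Type v} {R : Type w}
    [CommRing A] [CommRing B] [CommRing R] [Algebra A B] [Algebra A R]
    (hAB : IsCrispAlgebra A B) :
    (Algebra.FormallyUnramified B (B ⊗[A] R) → Algebra.FormallyUnramified A R) ∧
    (Algebra.Unramified B (B ⊗[A] R) → Algebra.Unramified A R) ∧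
    (Algebra.Etale B (B ⊗[A] R) → Algebra.Etale A R) ∧
    (Algebra.Smooth B (B ⊗[A] R) → Algebra.Smooth A R) := by
  refine ⟨fun _ ↦ hAB.formallyUnramified, fun _ ↦ ?_, fun _ ↦ ?_, fun _ ↦ hAB.smooth⟩
  · exact ⟨hAB.formallyUnramified, hAB.finiteType⟩
  · exact Algebra.Etale.iff_formallyUnramified_and_smooth.mpr
      ⟨hAB.formallyUnramified, hAB.smooth⟩
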